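/- All graphs are finite and simple. $P_t$ denotes the path on $t$ vertices, $G_1+G_2$ the disjoint union of two graphs, and $sG$ the disjoint union of $s$ copies of $G$. A graph $G$ is $H$-free if no induced subgraph of $G$ is isomorphic to $H$. A graph $G$ is probe $H$-free if its vertex set can be partitioned into a set $P$ of probes and a set $N$ of non-probes such that $N$ is independent in $G$ and, for some set $F\subseteq\binom{N}{2}$ of edges, the graph $G+F$ is $H$-free. For a fixed integer $k$, $k$-Colouring asks whether the vertices of a given graph can be coloured with $k$ colours so that adjacent vertices receive different colours. Theorem. Let $s\ge 0$. For every $k\ge 1$, $k$-Colouring is polynomial-time solvable on probe $(P_2+sP_1)$-free graphs; that is, there is a Turing machine that runs in polynomial time and that, given any probe $(P_2+sP_1)$-free graph $G$ (and no partition into probes and non-probes), decides whether $G$ has a $k$-colouring. Moreover, every probe $(P_2+sP_1)$-free graph is $(s+1)P_2$-free. -/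

import Mathlib

namespace ProbeColouring

/-- `G` is `H`-free: no induced subgraph of `G` is isomorphic to `H`. -/
def IsFree {V W : Type*} (H : SimpleGraph W) (G : SimpleGraph V) : Prop :=
  ¬ H.IsIndContained G

/-- `(G, P, N)` is a partitioned probe `H`-free graph: the vertex set is partitioned into the
probes `P` and the non-probes `N`, the set `N` is independent in `G`, and adding to `G` a
suitable set `F` of edges, all with both ends in `N`, gives an `H`-free graph. -/
def IsPartitionedProbeFree {V W : Type*} (H : SimpleGraph W) (G : SimpleGraph V)
    (P N : Set V) : Prop :=
  N = Pᶜ ∧ G.IsIndepSet N ∧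
    ∃ F : SimpleGraph V, (∀ u v, F.Adj u v → u ∈ N ∧ v ∈ N) ∧ IsFree H (G ⊔ F)

/-- `G` is probe `H`-free: some partition into probes and non-probes witnesses it. -/
def IsProbeFree {V W : Type*} (H : SimpleGraph W) (G : SimpleGraph V) : Prop :=
  ∃ P N : Set V, IsPartitionedProbeFree H G P N

/-- The disjoint union `sG` of `s` copies of `G`. -/
def copies {V : Type*} (s : ℕ) (G : SimpleGraph V) : SimpleGraph (Fin s × V) where
  Adj a b := a.1 = b.1 ∧ G.Adj a.2 b.2
  symm := ⟨fun _ _ h => ⟨h.1.symm, h.2.symm⟩⟩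
  loopless := ⟨fun _ h => G.loopless.irrefl _ h.2⟩

/-- The path `P_t` on `t` vertices. -/
abbrev path (t : ℕ) : SimpleGraph (Fin t) := SimpleGraph.pathGraph t

/-- The graph `P_2 + sP_1`. -/
abbrev P2sP1 (s : ℕ) : SimpleGraph (Fin 2 ⊕ Fin s × Fin 1) :=
  SimpleGraph.sum (path 2) (copies s (path 1))

/-- A finite graph given as an input: a number of vertices and a graph on `Fin n`. -/
abbrev InputGraph : Type := Σ n : ℕ, SimpleGraph (Fin n)

open Classical in
/-- The adjacency matrix of an input graph, written row by row over the three-letter alphabet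
`{some false, some true, none}`, every row being followed by the end-of-row mark `none`. -/
noncomputable def encodeGraph (x : InputGraph) : List (Option Bool) :=
  (List.finRange x.1).flatMap fun i =>
    (List.finRange x.1).map (fun j => some (decide (x.2.Adj i j))) ++ [none]

open Classical in
/-- The decision problem `Q` is polynomial-time solvable on the graph class `C`: a Turing machine
that runs in polynomial time answers correctly on every input graph from `C` (the input is
the graph alone; nothing is required of the machine outside `C`). -/
def PolyTimeSolvableOn (C Q : InputGraph → Prop) : Prop :=
  Nonempty (Turing.TM2ComputableInPolyTime
    (fun x : {x : InputGraph // C x} => encodeGraph x.1)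
    Computability.encodeBool
    (fun x => decide (Q x.1)))

end ProbeColouring

/-! Structure. Let `G + F` be `(P₂ + sP₁)`-free, and suppose that `G` has an induced matching with
`s + 1` edges. Non-probes are independent, so each of these edges has a probe end. Keep one edge
whole and one probe end of each other edge. Every edge of `F` joins two non-probes, so none joins
two kept vertices, and `G + F` contains an induced `P₂ + sP₁`, a contradiction
(`isFree_copies_of_isProbeFree`).

Colouring. Let `G` be `k`-coloured and `(s+1)P₂`-free. Enlarge a colour class to a maximal
independent set `J` and take a minimal `S ⊆ J` that dominates the complement of `J`; then `J = V ∖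
N(S)`. Each vertex of `S` has a private neighbour. If `|S| > ks`, then `s + 1` of these neighbours
share a colour and give an induced matching (`exists_small_dominating`). So `G` is `k`-colourable
iff there are `k` sets `S` of at most `ks` vertices whose sets `V ∖ N(S)` are independent and cover
`V`. For fixed `k` and `s` this is a sentence `∃ u, ∀ v w, φ` with a bounded number of variables,
and brute force decides it in polynomial time. No partition into probes and non-probes is needed.

Machine. The tape is the adjacency matrix, on which every variable marks its row and its column. One
sweep advances all variables as an odometer; the sweep back reads off the adjacencies between them,
a bounded amount of information. A finite-state sweeping automaton thus evaluates the sentence, and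
a stack machine simulates each sweep in linear time. -/

/-! ### Sweeping automata and the Turing machines that run them -/

namespace Sweep

open Turing

/-- Read a list from left to right with the transducer `f`, pushing the letters that it writes
onto `out`. -/
def pass {Q β γ : Type} (f : Q → β → Q × γ) : Q → List β → List γ → Q × List γ
  | q, [], out => (q, out)
  | q, b :: l, out => pass f (f q b).1 l ((f q b).2 :: out)

theorem pass_append {Q β γ : Type} (f : Q → β → Q × γ) (l₁ l₂ : List β) (q : Q) (out : List γ) :
    pass f q (l₁ ++ l₂) out = pass f (pass f q l₁ out).1 l₂ (pass f q l₁ out).2 := by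
  induction l₁ generalizing q out with
  | nil => rfl
  | cons b l ih => exact ih _ _

theorem pass_snd_length {Q β γ : Type} (f : Q → β → Q × γ) (l : List β) (q : Q) (out : List γ) :
    (pass f q l out).2.length = l.length + out.length := by
  induction l generalizing q out with
  | nil => simp [pass]
  | cons b l ih => simp only [pass, ih, List.length_cons]; omega

/-- Here `q p` is the invariant of a sweep: the state before position `p`. The output is reversed
because letters are pushed onto a stack. -/
theorem pass_range {Q β γ : Type} (f : Q → β → Q × γ) (q : ℕ → Q) (c : ℕ → β) (c' : ℕ → γ)
    (N : ℕ) (h : ∀ p < N, f (q p) (c p) = (q (p + 1), c' p)) (out : List γ) :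
    pass f (q 0) ((List.range N).map c) out = (q N, ((List.range N).map c').reverse ++ out) := by
  induction N with
  | zero => simp [pass]
  | succ N ih =>
    rw [List.range_succ, List.map_append, pass_append, ih fun p hp => h p (by omega)]
    simp [pass, h N (by omega)]

theorem pass_range_reverse {Q β γ : Type} (f : Q → β → Q × γ) (q : ℕ → Q) (c : ℕ → β) (c' : ℕ → γ)
    (N : ℕ) (h : ∀ p < N, f (q (p + 1)) (c p) = (q p, c' p)) (out : List γ) :
    pass f (q N) ((List.range N).map c).reverse out = (q 0, (List.range N).map c' ++ out) := by
  induction N generalizing out with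
  | zero => simp [pass]
  | succ N ih =>
    rw [List.range_succ, List.map_append, List.reverse_append]
    simp [pass, h N (by omega), ih fun p hp => h p (by omega)]

/-- A sweeping automaton with input alphabet `α`: it works on a tape of fixed length, over which
its head sweeps to and fro. After each backward sweep it either stops with a verdict or continues
from a new state. -/
structure Automaton (α : Type) where
  /-- the tape alphabet -/
  Γ : Type
  /-- the states -/
  Q : Type
  [finΓ : Finite Γ]
  [finQ : Finite Q]
  /-- some tape letter -/
  blank : Γ
  /-- the initial state -/
  start : Q
  /-- the transducer that reads the input in the first forward sweep -/
  load : Q → α → Q × Γ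
  /-- the transducer of the other forward sweeps -/
  fwd : Q → Γ → Q × Γ
  /-- the transducer of the backward sweeps -/
  bwd : Q → Γ → Q × Γ
  /-- the preparation of the state for a backward sweep -/
  turn : Q → Q
  /-- the decision after a backward sweep -/
  verdict : Q → Q ⊕ Bool

namespace Automaton

variable {α : Type} (A : Automaton α)

/-- `A.Decides t q l b`: a backward sweep over the list `l` from the state `q`, and then at most
`t - 1` further pairs of sweeps, lead to the verdict `b`. -/
inductive Decides : ℕ → A.Q → List A.Γ → Bool → Prop
  | halt {t : ℕ} {q : A.Q} {l : List A.Γ} {b : Bool}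
      (h : A.verdict (pass A.bwd q l []).1 = Sum.inr b) : Decides (t + 1) q l b
  | next {t : ℕ} {q q' : A.Q} {l : List A.Γ} {b : Bool}
      (h : A.verdict (pass A.bwd q l []).1 = Sum.inl q')
      (h' : Decides t (A.turn (pass A.fwd q' (pass A.bwd q l []).2 []).1)
        (pass A.fwd q' (pass A.bwd q l []).2 []).2 b) : Decides (t + 1) q l b

theorem Decides.mono {A : Automaton α} {t t' : ℕ} {q : A.Q} {l : List A.Γ} {b : Bool}
    (h : A.Decides t q l b) (htt' : t ≤ t') : A.Decides t' q l b := by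
  induction h generalizing t' with
  | halt h =>
    obtain ⟨t', rfl⟩ := Nat.exists_eq_succ_of_ne_zero (show t' ≠ 0 by omega)
    exact .halt h
  | next h _ ih =>
    obtain ⟨t', rfl⟩ := Nat.exists_eq_succ_of_ne_zero (show t' ≠ 0 by omega)
    exact .next h (ih (by omega))

/-! ### Simulation of sweeps by a machine with four stacks -/

/-- The stacks of the machine. -/
inductive Stk
  | input
  | output
  | left
  | right
  deriving DecidableEq

instance : Fintype Stk :=
  ⟨{.input, .output, .left, .right}, fun k => by cases k <;> decide⟩

/-- The labels of the machine. -/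
inductive Lab
  | load
  | scan
  | shift
  | clean (b : Bool)
  deriving Fintype

/-- The stack alphabets of the machine. -/
def Alph : Stk → Type
  | .input => α
  | .output => Bool
  | .left => A.Γ
  | .right => A.Γ

/-- The internal states of the machine. -/
abbrev Var : Type := A.Q × Option A.Γ

/-- The internal state after reading `o` with the transducer `f`. -/
def feed {β : Type} (f : A.Q → β → A.Q × A.Γ) (s : A.Var) : Option β → A.Var
  | none => (s.1, none)
  | some g => ((f s.1 g).1, some (f s.1 g).2)

/-- The label after a backward sweep. -/
def labelOf : A.Q ⊕ Bool → Lab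
  | .inl _ => .shift
  | .inr b => .clean b

/-- The state after a backward sweep. -/
def stateOf (q : A.Q) : A.Q ⊕ Bool → A.Q
  | .inl q' => q'
  | .inr _ => q

open TM2.Stmt in
/-- The program of the machine. -/
def program : Lab → TM2.Stmt A.Alph Lab A.Var
  | .load => pop Stk.input (A.feed A.load)
      (branch (fun s => s.2.isSome)
        (push Stk.right (fun s => (s.2.getD A.blank : A.Γ)) (goto fun _ => .load))
        (TM2.Stmt.load (fun s => (A.turn s.1, none)) (goto fun _ => .scan)))
  | .scan => pop Stk.right (A.feed A.bwd)
      (branch (fun s => s.2.isSome)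
        (push Stk.left (fun s => (s.2.getD A.blank : A.Γ)) (goto fun _ => .scan))
        (branch (fun s => (A.verdict s.1).isLeft)
          (TM2.Stmt.load (fun s => (A.stateOf s.1 (A.verdict s.1), none)) (goto fun _ => .shift))
          (goto fun s => A.labelOf (A.verdict s.1))))
  | .shift => pop Stk.left (A.feed A.fwd)
      (branch (fun s => s.2.isSome)
        (push Stk.right (fun s => (s.2.getD A.blank : A.Γ)) (goto fun _ => .shift))
        (TM2.Stmt.load (fun s => (A.turn s.1, none)) (goto fun _ => .scan)))
  | .clean b => pop Stk.left (fun s (o : Option A.Γ) => (s.1, o))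
      (branch (fun s => s.2.isSome)
        (goto fun _ => .clean b)
        (push Stk.output (fun _ => b) (TM2.Stmt.load (fun _ => (A.start, none)) halt)))

/-- The contents of the four stacks. -/
def contents (i : List α) (o : List Bool) (l r : List A.Γ) : ∀ k, List (A.Alph k)
  | .input => i
  | .output => o
  | .left => l
  | .right => r

/-- The Turing machine that runs `A`. -/
noncomputable def machine [Fintype α] : FinTM2 :=
  haveI := A.finΓ
  haveI := A.finQ
  { K := Stk
    k₀ := .input
    k₁ := .output
    Γ := A.Alph
    Λ := Lab
    main := .load
    σ := A.Var
    initialState := (A.start, none)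
    σFin := Fintype.ofFinite _
    Γk₀Fin := inferInstanceAs (Fintype α)
    m := A.program }

/-- The machine needs at most `t` steps from the configuration `c` to `c'`. -/
def Run (t : ℕ) (c c' : TM2.Cfg A.Alph Lab A.Var) : Prop :=
  ∃ m ≤ t, (flip bind (TM2.step A.program))^[m] (some c) = some c'

variable {A}

theorem Run.trans {t t' : ℕ} {c c' c'' : TM2.Cfg A.Alph Lab A.Var} (h : A.Run t c c')
    (h' : A.Run t' c' c'') : A.Run (t + t') c c'' := by
  obtain ⟨m, hm, h⟩ := h
  obtain ⟨m', hm', h'⟩ := h'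
  exact ⟨m' + m, by omega, by rw [Function.iterate_add_apply, h, h']⟩

theorem Run.mono {t t' : ℕ} {c c' : TM2.Cfg A.Alph Lab A.Var} (h : A.Run t c c')
    (htt' : t ≤ t') : A.Run t' c c' := by
  obtain ⟨m, hm, h⟩ := h
  exact ⟨m, by omega, h⟩

theorem Run.single {c c' : TM2.Cfg A.Alph Lab A.Var} (h : TM2.step A.program c = some c') :
    A.Run 1 c c' := ⟨1, le_rfl, h⟩

theorem Run.head {t : ℕ} {c c' c'' : TM2.Cfg A.Alph Lab A.Var}
    (h : TM2.step A.program c = some c') (h' : A.Run t c' c'') : A.Run (t + 1) c c'' := by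
  rw [add_comm]
  exact (Run.single h).trans h'

variable (A)

theorem run_load (i : List α) (l r : List A.Γ) (q : A.Q) (o : Option A.Γ) :
    A.Run (i.length + 1) ⟨some .load, (q, o), A.contents i [] l r⟩
      ⟨some .scan, (A.turn (pass A.load q i r).1, none),
        A.contents [] [] l (pass A.load q i r).2⟩ := by
  induction i generalizing q o r with
  | nil =>
    apply Run.single
    simp only [TM2.step, program, TM2.stepAux, contents, List.head?, List.tail, feed,
      Option.isSome, cond, pass]
    exact congrArg (fun S => some (TM2.Cfg.mk _ _ S)) (by funext k; cases k <;> rfl)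
  | cons a i ih =>
    refine Run.head ?_ (ih _ _ (some (A.load q a).2))
    simp only [TM2.step, program, TM2.stepAux, contents, List.head?,
      List.tail, feed, Option.isSome, cond, Option.getD]
    exact congrArg (fun S => some (TM2.Cfg.mk _ _ S)) (by funext k; cases k <;> rfl)

theorem run_shift (l r : List A.Γ) (q : A.Q) (o : Option A.Γ) :
    A.Run (l.length + 1) ⟨some .shift, (q, o), A.contents [] [] l r⟩
      ⟨some .scan, (A.turn (pass A.fwd q l r).1, none),
        A.contents [] [] [] (pass A.fwd q l r).2⟩ := by
  induction l generalizing q o r with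
  | nil =>
    apply Run.single
    simp only [TM2.step, program, TM2.stepAux, contents, List.head?, List.tail, feed,
      Option.isSome, cond, pass]
    exact congrArg (fun S => some (TM2.Cfg.mk _ _ S)) (by funext k; cases k <;> rfl)
  | cons a i ih =>
    refine Run.head ?_ (ih _ _ (some (A.fwd q a).2))
    simp only [TM2.step, program, TM2.stepAux, contents, List.head?,
      List.tail, feed, Option.isSome, cond, Option.getD]
    exact congrArg (fun S => some (TM2.Cfg.mk _ _ S)) (by funext k; cases k <;> rfl)

theorem run_scan (l r : List A.Γ) (q : A.Q) (o : Option A.Γ) :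
    A.Run (r.length + 1) ⟨some .scan, (q, o), A.contents [] [] l r⟩
      ⟨some (A.labelOf (A.verdict (pass A.bwd q r l).1)),
        (A.stateOf (pass A.bwd q r l).1 (A.verdict (pass A.bwd q r l).1), none),
        A.contents [] [] (pass A.bwd q r l).2 []⟩ := by
  induction r generalizing q o l with
  | nil =>
    apply Run.single
    simp only [TM2.step, program, TM2.stepAux, contents, List.head?, List.tail, feed,
      Option.isSome, cond, pass]
    rcases A.verdict q with q' | b <;>
      exact congrArg (fun S => some (TM2.Cfg.mk _ _ S)) (by funext k; cases k <;> rfl)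
  | cons a i ih =>
    refine Run.head ?_ (ih _ _ (some (A.bwd q a).2))
    simp only [TM2.step, program, TM2.stepAux, contents, List.head?,
      List.tail, feed, Option.isSome, cond, Option.getD]
    exact congrArg (fun S => some (TM2.Cfg.mk _ _ S)) (by funext k; cases k <;> rfl)

/-- A halting configuration with output must have all other stacks empty and the initial internal
state. -/
theorem run_clean (l : List A.Γ) (b : Bool) (q : A.Q) (o : Option A.Γ) :
    A.Run (l.length + 1) ⟨some (.clean b), (q, o), A.contents [] [] l []⟩
      ⟨none, (A.start, none), A.contents [] [b] [] []⟩ := by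
  induction l generalizing o with
  | nil =>
    apply Run.single
    simp only [TM2.step, program, TM2.stepAux, contents, List.head?, List.tail,
      Option.isSome, cond]
    exact congrArg (fun S => some (TM2.Cfg.mk _ _ S)) (by funext k; cases k <;> rfl)
  | cons a i ih =>
    refine Run.head ?_ (ih (some a))
    simp only [TM2.step, program, TM2.stepAux, contents, List.head?, List.tail,
      Option.isSome, cond]
    exact congrArg (fun S => some (TM2.Cfg.mk _ _ S)) (by funext k; cases k <;> rfl)

theorem run_of_decides {t : ℕ} {q : A.Q} {r : List A.Γ} {b : Bool} (h : A.Decides t q r b)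
    (o : Option A.Γ) :
    A.Run (2 * t * (r.length + 1)) ⟨some .scan, (q, o), A.contents [] [] [] r⟩
      ⟨none, (A.start, none), A.contents [] [b] [] []⟩ := by
  induction h generalizing o with
  | @halt t q r b h =>
    have h₁ := A.run_scan [] r q o
    rw [h] at h₁
    -- One backward sweep and one cleaning, each of `r.length + 1` steps, fit into the cost of a
    -- single pair of sweeps.
    refine (h₁.trans (A.run_clean _ b _ _)).mono ?_
    rw [pass_snd_length]
    simp only [List.length_nil, add_zero]
    nlinarith
  | @next t q q' r b h h' ih =>
    have h₁ := A.run_scan [] r q o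
    rw [h] at h₁
    refine ((h₁.trans (A.run_shift _ [] q' none)).trans (ih none)).mono ?_
    simp only [pass_snd_length, List.length_nil, add_zero]
    apply le_of_eq
    ring

theorem outputs [Fintype α] (w : List α) (b : Bool) (t : ℕ)
    (h : A.Decides t (A.turn (pass A.load A.start w []).1) (pass A.load A.start w []).2 b) :
    Nonempty (TM2OutputsInTime A.machine w (some [b]) ((2 * t + 1) * (w.length + 1))) := by
  obtain ⟨m, hm, hrun⟩ := (A.run_load w [] [] A.start none).trans (A.run_of_decides h none)
  refine ⟨⟨m, ?_⟩, ?_⟩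
  · have h₁ : initList A.machine w = ⟨some .load, (A.start, none), A.contents w [] [] []⟩ := by
      unfold initList
      congr 1
      funext k
      cases k <;> rfl
    have h₂ : haltList A.machine [b] = ⟨none, (A.start, none), A.contents [] [b] [] []⟩ := by
      unfold haltList
      congr 1
      funext k
      cases k <;> rfl
    rw [h₁, Option.map_some, h₂]
    exact hrun
  · refine hm.trans (le_of_eq ?_)
    simp only [pass_snd_length, List.length_nil, add_zero]
    ring

end Automaton

/-- A sweeping automaton that decides `Q` on `C` with polynomially many sweeps yields a
polynomial-time Turing machine. -/
theorem polyTimeSolvableOn_of_automaton {C Q : ProbeColouring.InputGraph → Prop}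
    (A : Automaton (Option Bool)) (t : Polynomial ℕ)
    (h : ∀ x, C x → ∃ b : Bool, (b = true ↔ Q x) ∧
      A.Decides (t.eval (ProbeColouring.encodeGraph x).length)
        (A.turn (pass A.load A.start (ProbeColouring.encodeGraph x) []).1)
        (pass A.load A.start (ProbeColouring.encodeGraph x) []).2 b) :
    ProbeColouring.PolyTimeSolvableOn C Q := by
  classical
  refine ⟨⟨⟨A.machine, Equiv.refl _, Equiv.refl _⟩, (2 * t + 1) * (Polynomial.X + 1), ?_⟩⟩
  intro x
  have hx : Nonempty (TM2OutputsInTime A.machine (ProbeColouring.encodeGraph x.1)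
      (some [decide (Q x.1)])
      ((2 * t.eval (ProbeColouring.encodeGraph x.1).length + 1) *
        ((ProbeColouring.encodeGraph x.1).length + 1))) := by
    obtain ⟨b, hb, hdec⟩ := h x.1 x.2
    have : b = decide (Q x.1) := by
      rw [Bool.eq_iff_iff, hb, decide_eq_true_iff]
    rw [← this]
    exact A.outputs _ b _ hdec
  have hx' := hx.some
  have e₁ : List.map (Equiv.refl (A.machine.Γ A.machine.k₀)).invFun
      (ProbeColouring.encodeGraph x.1) = ProbeColouring.encodeGraph x.1 := List.map_id _
  have e₂ : (((2 * t + 1) * (Polynomial.X + 1) : Polynomial ℕ)).eval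
      (ProbeColouring.encodeGraph x.1).length =
      (2 * t.eval (ProbeColouring.encodeGraph x.1).length + 1) *
        ((ProbeColouring.encodeGraph x.1).length + 1) := by
    simp
  rw [e₂]
  exact e₁.symm ▸ hx'

end Sweep

/-! ### An automaton that counts through all tuples of vertices -/

namespace Sweep

open Automaton

/-! ### Arithmetic of the odometer -/

/-- The tuple `x` after one step of an odometer with digits `0, …, n`, lowest digit first. -/
def succTuple {M : ℕ} (n : ℕ) (x : Fin M → ℕ) (k : Fin M) : ℕ :=
  if ∀ l < k, x l = n then (x k + 1) % (n + 1) else x k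

/-- The first `M` digits of `c` in base `B`. -/
def digits (M B c : ℕ) (k : Fin M) : ℕ := c / B ^ (k : ℕ) % B

/-- This is the carry rule: adding 1 carries past the lowest `i` digits exactly when all of them are
maximal. -/
theorem forall_digits_eq_iff {M n c i : ℕ} (hi : i ≤ M) :
    (∀ l : Fin M, (l : ℕ) < i → digits M (n + 1) c l = n) ↔ (n + 1) ^ i ∣ c + 1 := by
  induction i with
  | zero => simp
  | succ i ih =>
    have h₁ : (∀ l : Fin M, (l : ℕ) < i + 1 → digits M (n + 1) c l = n) ↔
        (∀ l : Fin M, (l : ℕ) < i → digits M (n + 1) c l = n) ∧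
          c / (n + 1) ^ i % (n + 1) = n := by
      constructor
      · exact fun h => ⟨fun l hl => h l (by omega), h ⟨i, by omega⟩ (Nat.lt_succ_self i)⟩
      · rintro ⟨h, h'⟩ l hl
        rcases Nat.lt_succ_iff_lt_or_eq.1 hl with hl | hl
        · exact h l hl
        · simpa [digits, hl] using h'
    have h₂ : c / (n + 1) ^ i % (n + 1) = n ↔ n + 1 ∣ c / (n + 1) ^ i + 1 := by
      rw [Nat.dvd_iff_mod_eq_zero, Nat.add_mod]
      have := Nat.mod_lt (c / (n + 1) ^ i) (show 0 < n + 1 by omega)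
      constructor
      · intro h
        rw [h]
        rcases n with _ | n
        · simp
        · simp
      · intro h
        by_contra hne
        have hlt : c / (n + 1) ^ i % (n + 1) + 1 < n + 1 := by omega
        rcases n with _ | n
        · omega
        · rw [Nat.mod_eq_of_lt (show 1 < n + 1 + 1 by omega), Nat.mod_eq_of_lt hlt] at h
          omega
    rw [h₁, ih (by omega), h₂]
    constructor
    · rintro ⟨h, h'⟩
      have : (c + 1) / (n + 1) ^ i = c / (n + 1) ^ i + 1 := Nat.succ_div_of_dvd h
      rw [← this] at h'
      rw [pow_succ]
      obtain ⟨d, hd⟩ := h'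
      refine ⟨d, ?_⟩
      rw [mul_assoc, ← hd, Nat.mul_div_cancel' h]
    · intro h
      have h' : (n + 1) ^ i ∣ c + 1 := (pow_dvd_pow _ i.le_succ).trans h
      refine ⟨h', ?_⟩
      rw [← Nat.succ_div_of_dvd h']
      obtain ⟨d, hd⟩ := h
      refine ⟨d, ?_⟩
      rw [hd, pow_succ, mul_assoc, Nat.mul_div_cancel_left _ (by positivity)]

theorem succTuple_digits (M n c : ℕ) :
    succTuple n (digits M (n + 1) c) = digits M (n + 1) (c + 1) := by
  funext k
  have h : (∀ l < k, digits M (n + 1) c l = n) ↔ (n + 1) ^ (k : ℕ) ∣ c + 1 :=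
    forall_digits_eq_iff k.2.le
  unfold succTuple
  rw [if_congr h rfl rfl]
  unfold digits
  split_ifs with h'
  · rw [Nat.succ_div_of_dvd h']
    simp
  · rw [Nat.succ_div_of_not_dvd h']

/-! ### The counting automaton -/

/-- The letters of the tape: an input letter, and the sets of variables whose values are the row
and the column of the cell. -/
abbrev Cell (M : ℕ) : Type := Option Bool × (Fin M → Bool) × (Fin M → Bool)

/-- The states of the counting automaton. -/
structure State (M : ℕ) where
  /-- the variables whose value is not a vertex -/
  miss : Fin M → Bool
  /-- the row marks of the preceding row -/
  row : Fin M → Bool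
  /-- the column marks of the preceding cell -/
  col : Fin M → Bool
  /-- the adjacencies between the variables -/
  pat : Fin M → Fin M → Bool
  /-- whether the universally quantified condition has held so far -/
  ok : Bool

instance (M : ℕ) : Finite (State M) :=
  Finite.of_injective (fun s : State M => (s.miss, s.row, s.col, s.pat, s.ok)) <| by
    rintro ⟨⟩ ⟨⟩ h
    simpa using h

namespace State

variable {M : ℕ}

/-- Move the marks of the variables that the odometer advances. -/
def shift (s : State M) (g : Cell M) : State M × Cell M :=
  ({ s with row := if g.1 = none then g.2.1 else s.row, col := g.2.2 },
    (g.1, fun k => if ∀ l < k, s.miss l = true then s.row k else g.2.1 k,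
      fun k => if ∀ l < k, s.miss l = true then s.col k else g.2.2 k))

/-- Collect the adjacencies between the variables. -/
def scan (s : State M) (g : Cell M) : State M × Cell M :=
  ({ s with
      miss := fun k => s.miss k && !g.2.1 k
      pat := fun i j => s.pat i j || (decide (g.1 = some true) && g.2.1 i && g.2.2 j) }, g)

/-- Forget the collected information. -/
def reset (s : State M) : State M :=
  { s with miss := fun _ => true, pat := fun _ _ => false }

/-- The state before the input is read. -/
def start : State M := ⟨fun _ => true, fun _ => true, fun _ => true, fun _ _ => false, true⟩

/-- The state in which the next tuple is produced. -/
def prepare (s : State M) (b : Bool) : State M := { s with row := s.miss, col := s.miss, ok := b }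

/-- Evaluate the condition `φ` on the present tuple, and end if the answer is known. -/
def verdict {m : ℕ} (φ : (Fin (m + 2) → Fin (m + 2) → Bool) → Bool) (s : State (m + 2)) :
    State (m + 2) ⊕ Bool :=
  if s.miss 0 = true ∧ s.miss 1 = true then
    if (s.ok && φ s.pat) = true then .inr true
    else if ∀ k, s.miss k = true then .inr false else .inl (s.prepare true)
  else .inl (s.prepare (s.ok && φ s.pat))

end State

/-- The automaton that decides whether there are values of the variables `2, …, m + 1` such that
for all values of the variables `0` and `1` the adjacencies satisfy `φ`. -/
def counter {m : ℕ} (φ : (Fin (m + 2) → Fin (m + 2) → Bool) → Bool) : Automaton (Option Bool) where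
  Γ := Cell (m + 2)
  Q := State (m + 2)
  blank := (none, fun _ => false, fun _ => false)
  start := State.start
  load s a := s.shift (a, fun _ => false, fun _ => decide (a = none))
  fwd := State.shift
  bwd := State.scan
  turn := State.reset
  verdict := State.verdict φ

/-- The letter at position `p` of the encoding of a graph with adjacency `α` on `n` vertices. -/
def letter (n : ℕ) (α : ℕ → ℕ → Bool) (p : ℕ) : Option Bool :=
  if p % (n + 1) < n then some (α (p / (n + 1)) (p % (n + 1))) else none

/-! ### What a single sweep computes -/

section

variable {M : ℕ} (n : ℕ) (α : ℕ → ℕ → Bool) (x : Fin M → ℕ)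

/-- The tape letter at position `p` for the tuple `x`. -/
def cell (p : ℕ) : Cell M :=
  (letter n α p, fun k => decide (x k = p / (n + 1)), fun k => decide (x k = p % (n + 1)))

/-- The tape for the tuple `x`. -/
def tape : List (Cell M) := (List.range (n * (n + 1))).map (cell n α x)

/-- The adjacencies between the entries of `x`; the entry `n` is adjacent to nothing. -/
def pattern (i j : Fin M) : Bool := decide (x i < n ∧ x j < n ∧ α (x i) (x j) = true)

/-- The state of the shifting transducer at position `p`. -/
def shiftState (s : State M) (p : ℕ) : State M :=
  { s with
    row := fun k => decide ((x k + 1) % (n + 1) = p / (n + 1))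
    col := fun k => decide ((x k + 1) % (n + 1) = p % (n + 1)) }

variable {n x}

theorem succ_mod_eq_iff {a b : ℕ} (ha : a ≤ n) (hb : b ≤ n) :
    (a + 1) % (n + 1) = (b + 1) % (n + 1) ↔ a = b := by
  constructor
  · intro h
    have h' : a ≡ b [MOD n + 1] := Nat.ModEq.add_right_cancel' 1 h
    exact h'.eq_of_lt_of_lt (by omega) (by omega)
  · rintro rfl
    rfl

/-- Advancing a variable moves its column mark one cell to the right and its row mark one row down,
so remembering the preceding cell and row suffices. The row memory is renewed only at end-of-row
marks. The value `n` has no row, and its column is that of the end-of-row marks; it wraps around to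
0. -/
theorem shift_shiftState (hx : ∀ k, x k ≤ n) (s : State M)
    (hs : ∀ k, s.miss k = decide (x k = n)) {p : ℕ} (hp : p < n * (n + 1)) :
    (shiftState n x s p).shift (cell n α x p) =
      (shiftState n x s (p + 1), cell n α (succTuple n x) p) := by
  have hrow : p / (n + 1) < n := Nat.div_lt_of_lt_mul (by rwa [mul_comm])
  have hcol : p % (n + 1) ≤ n := Nat.lt_succ_iff.1 (Nat.mod_lt _ n.succ_pos)
  have hcol' : ∀ k, ((x k + 1) % (n + 1) = (p + 1) % (n + 1)) ↔ x k = p % (n + 1) := by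
    intro k
    rw [← succ_mod_eq_iff (hx k) hcol, Nat.mod_add_mod]
  have hrow' : ∀ k, ((x k + 1) % (n + 1) = (p + 1) / (n + 1)) ↔
      if letter n α p = none then x k = p / (n + 1)
      else (x k + 1) % (n + 1) = p / (n + 1) := by
    intro k
    unfold letter
    by_cases h : p % (n + 1) < n
    · rw [if_pos h, if_neg (by simp), Nat.succ_div_of_not_dvd]
      intro hd
      rw [Nat.dvd_iff_mod_eq_zero, Nat.add_mod, Nat.mod_eq_of_lt (show 1 < n + 1 by omega),
        Nat.mod_eq_of_lt (by omega)] at hd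
      omega
    · have hn : p % (n + 1) = n := by omega
      rw [if_neg h, if_pos rfl, Nat.succ_div_of_dvd,
        ← succ_mod_eq_iff (hx k) hrow.le, Nat.mod_eq_of_lt (show p / (n + 1) + 1 < n + 1 by omega)]
      refine ⟨p / (n + 1) + 1, ?_⟩
      have := Nat.div_add_mod p (n + 1)
      rw [hn] at this
      linarith
  have hs' : ∀ k, (∀ l < k, s.miss l = true) ↔ ∀ l < k, x l = n := by simp [hs]
  unfold State.shift
  refine Prod.ext ?_ (Prod.ext rfl (Prod.ext ?_ ?_))
  · simp only [shiftState, cell, hcol', hrow', State.mk.injEq, true_and, and_true]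
    by_cases h : letter n α p = none
    · simp only [if_pos h]
      exact if_pos h
    · simp only [if_neg h]
      exact if_neg h
  · funext k
    simp only [shiftState, cell, succTuple, hs']
    split_ifs <;> rfl
  · funext k
    simp only [shiftState, cell, succTuple, hs']
    split_ifs <;> rfl

theorem pass_shift (hx : ∀ k, x k ≤ n) (s : State M)
    (hs : ∀ k, s.miss k = decide (x k = n)) (b : Bool) :
    pass State.shift (s.prepare b) (tape n α x) [] =
      (shiftState n x (s.prepare b) (n * (n + 1)), (tape n α (succTuple n x)).reverse) := by
  have h : s.prepare b = shiftState n x (s.prepare b) 0 := by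
    have : ∀ k, (x k + 1) % (n + 1) = 0 ↔ x k = n := by
      intro k
      rw [← succ_mod_eq_iff (hx k) le_rfl, Nat.mod_self]
    simp only [State.prepare, shiftState, Nat.zero_div, Nat.zero_mod, this, State.mk.injEq,
      true_and, and_true]
    exact ⟨funext hs, funext hs⟩
  conv_lhs => rw [h]
  unfold tape
  rw [pass_range _ (shiftState n x (s.prepare b)) (cell n α x) (cell n α (succTuple n x))]
  · rw [List.append_nil]
  · exact fun p hp => shift_shiftState α hx (s.prepare b) hs hp

/-- Loading is a shift from the tape of the constant tuple `n`: that tape has no row marks, and its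
column marks sit exactly on the end-of-row letters. The odometer therefore starts at 0. -/
theorem pass_load {m : ℕ} (φ : (Fin (m + 2) → Fin (m + 2) → Bool) → Bool) :
    pass (counter φ).load (counter φ).start ((List.range (n * (n + 1))).map (letter n α)) [] =
      (shiftState n (fun _ => n) State.start (n * (n + 1)),
        (tape n α (digits (m + 2) (n + 1) 0)).reverse) := by
  have h : State.start = shiftState (M := m + 2) n (fun _ => n) State.start 0 := by
    simp [State.start, shiftState]
  change pass (fun (s : State (m + 2)) a =>
    s.shift (a, fun _ => false, fun _ => decide (a = none))) State.start _ [] = _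
  conv_lhs => rw [h]
  unfold tape
  rw [pass_range _ (shiftState n (fun _ => n) State.start) (letter n α)
    (cell n α (digits (m + 2) (n + 1) 0))]
  · rw [List.append_nil]
  · intro p hp
    have hd : digits (m + 2) (n + 1) 0 = succTuple n fun _ => n := by
      funext k
      simp [digits, succTuple]
    rw [hd, ← shift_shiftState α (fun _ => le_rfl) _ (by simp [State.start]) hp]
    have hrow : p / (n + 1) < n := Nat.div_lt_of_lt_mul (by rwa [mul_comm])
    have hcol : p % (n + 1) ≤ n := Nat.lt_succ_iff.1 (Nat.mod_lt _ n.succ_pos)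
    show State.shift _ _ = _
    congr 1
    refine Prod.ext rfl (Prod.ext ?_ ?_)
    · funext k
      simp [cell, hrow.ne']
    · funext k
      simp only [cell, letter]
      split_ifs with h' <;> simp <;> omega

theorem pass_scan (hx : ∀ k, x k ≤ n) (s : State M) (hmiss : s.miss = fun _ => true)
    (hpat : s.pat = fun _ _ => false) :
    pass State.scan s (tape n α x).reverse [] =
      ({ s with miss := fun k => decide (x k = n), pat := pattern n α x }, tape n α x) := by
  classical
  set N := n * (n + 1) with hN
  -- The invariant of the backward sweep: what the cells from position `p` onwards reveal.
  let q : ℕ → State M := fun p =>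
    { s with
      miss := fun k => decide (∀ r, p ≤ r → r < N → x k ≠ r / (n + 1))
      pat := fun i j => decide (∃ r, p ≤ r ∧ r < N ∧ letter n α r = some true ∧
        x i = r / (n + 1) ∧ x j = r % (n + 1)) }
  have h₁ : s = q N := by
    obtain ⟨miss, row, col, pat, ok⟩ := s
    subst hmiss hpat
    simp only [q, State.mk.injEq, true_and, and_true]
    constructor
    · funext k
      refine (decide_eq_true fun r h h' => ?_).symm
      omega
    · funext i j
      refine (decide_eq_false ?_).symm
      rintro ⟨r, h, h', -⟩
      omega
  have h₂ : q 0 = { s with miss := fun k => decide (x k = n), pat := pattern n α x } := by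
    simp only [q, State.mk.injEq, true_and, and_true]
    constructor
    · funext k
      rw [decide_eq_decide]
      constructor
      · intro h
        by_contra hne
        have hlt : x k < n := lt_of_le_of_ne (hx k) hne
        refine h (x k * (n + 1)) (Nat.zero_le _) ?_ ?_
        · exact Nat.mul_lt_mul_of_pos_right hlt n.succ_pos
        · rw [Nat.mul_div_cancel _ n.succ_pos]
      · intro h r _ hr h'
        have : r / (n + 1) < n := Nat.div_lt_of_lt_mul (by rwa [mul_comm])
        omega
    · funext i j
      unfold pattern
      rw [decide_eq_decide]
      constructor
      · rintro ⟨r, _, hr, hl, hi, hj⟩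
        have : r / (n + 1) < n := Nat.div_lt_of_lt_mul (by rwa [mul_comm])
        unfold letter at hl
        rw [← hi, ← hj] at hl
        split_ifs at hl with h
        exact ⟨by omega, h, by simpa using hl⟩
      · rintro ⟨hi, hj, h⟩
        have e₁ : (x i * (n + 1) + x j) / (n + 1) = x i := by
          rw [mul_comm, Nat.mul_add_div n.succ_pos, Nat.div_eq_of_lt (by omega), add_zero]
        have e₂ : (x i * (n + 1) + x j) % (n + 1) = x j := by
          rw [mul_comm, Nat.mul_add_mod, Nat.mod_eq_of_lt (by omega)]
        refine ⟨x i * (n + 1) + x j, Nat.zero_le _, ?_, ?_, e₁.symm, e₂.symm⟩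
        · calc x i * (n + 1) + x j < x i * (n + 1) + (n + 1) := by omega
            _ = (x i + 1) * (n + 1) := by ring
            _ ≤ N := Nat.mul_le_mul_right _ hi
        · unfold letter
          rw [e₁, e₂, if_pos hj, h]
  conv_lhs => rw [h₁]
  unfold tape
  rw [pass_range_reverse _ q (cell n α x) (cell n α x), List.append_nil, h₂]
  intro p hp
  refine Prod.ext ?_ rfl
  simp only [State.scan, q, cell, State.mk.injEq, true_and, and_true]
  constructor
  · funext k
    rw [Bool.eq_iff_iff]
    simp only [Bool.and_eq_true, decide_eq_true_eq, Bool.not_eq_true', decide_eq_false_iff_not]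
    constructor
    · rintro ⟨h, h'⟩ r hr hr'
      rcases hr.eq_or_lt with rfl | hr
      · exact h'
      · exact h r hr hr'
    · exact fun h => ⟨fun r hr => h r (by omega), h p le_rfl hp⟩
  · funext i j
    rw [Bool.eq_iff_iff]
    simp only [Bool.and_eq_true, Bool.or_eq_true, decide_eq_true_eq]
    constructor
    · rintro (⟨r, h, h'⟩ | ⟨⟨h, h'⟩, h''⟩)
      · exact ⟨r, by omega, h'⟩
      · exact ⟨p, le_rfl, hp, of_decide_eq_true h, h', h''⟩
    · rintro ⟨r, hr, hr', h, h', h''⟩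
      rcases hr.eq_or_lt with rfl | hr
      · exact Or.inr ⟨⟨decide_eq_true h, h'⟩, h''⟩
      · exact Or.inl ⟨r, hr, hr', h, h', h''⟩

end

/-! ### The count through all tuples -/

section

variable {m : ℕ} (φ : (Fin (m + 2) → Fin (m + 2) → Bool) → Bool) (n : ℕ) (α : ℕ → ℕ → Bool)

theorem digits_le (M c : ℕ) (k : Fin M) : digits M (n + 1) c k ≤ n :=
  Nat.lt_succ_iff.1 (Nat.mod_lt _ n.succ_pos)

/-- The condition `φ` for the tuple of the digits of `c`. -/
def cond (c : ℕ) : Bool := φ (pattern n α (digits (m + 2) (n + 1) c))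

open Classical in
-- Consecutive counts form blocks of `(n + 1) ^ 2` with a common choice of the existential
-- variables. By `hok`, the flag records whether `φ` held on the part of the current block already
-- seen. The verdict concerns the current block, including that part, and all later ones.
theorem counter_decides (t c : ℕ) (hc : c + t = (n + 1) ^ (m + 2)) (ht : 0 < t)
    (s : State (m + 2)) (hmiss : s.miss = fun _ => true) (hpat : s.pat = fun _ _ => false)
    (hok : s.ok = decide (∀ r < c % (n + 1) ^ 2,
      cond φ n α ((n + 1) ^ 2 * (c / (n + 1) ^ 2) + r) = true)) :
    (counter φ).Decides t s (tape n α (digits (m + 2) (n + 1) c)).reverse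
      (decide (∃ e, c / (n + 1) ^ 2 ≤ e ∧ e < (n + 1) ^ m ∧
        ∀ r < (n + 1) ^ 2, cond φ n α ((n + 1) ^ 2 * e + r) = true)) := by
  induction t generalizing c s with
  | zero => omega
  | succ t ih =>
    set D := (n + 1) ^ 2 with hD
    have hDpos : 0 < D := by positivity
    have hpow : (n + 1) ^ (m + 2) = D * (n + 1) ^ m := by rw [hD]; ring
    have hx := digits_le n (m + 2) c
    have hscan := pass_scan α hx s hmiss hpat
    have h01 : (digits (m + 2) (n + 1) c 0 = n ∧ digits (m + 2) (n + 1) c 1 = n) ↔ D ∣ c + 1 := by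
      rw [hD, ← forall_digits_eq_iff (show 2 ≤ m + 2 by omega)]
      constructor
      · rintro ⟨h0, h1⟩ l hl
        have : l = 0 ∨ l = 1 := by
          rw [Fin.ext_iff, Fin.ext_iff]
          simp only [Fin.val_zero, Fin.val_one]
          omega
        rcases this with rfl | rfl
        exacts [h0, h1]
      · exact fun h => ⟨h 0 (by simp), h 1 (by simp)⟩
    have hall : (∀ k, digits (m + 2) (n + 1) c k = n) ↔ t = 0 := by
      have : (∀ k, digits (m + 2) (n + 1) c k = n) ↔ (n + 1) ^ (m + 2) ∣ c + 1 := by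
        rw [← forall_digits_eq_iff le_rfl]
        exact ⟨fun h l _ => h l, fun h l => h l l.2⟩
      rw [this]
      constructor
      · intro h
        have := Nat.le_of_dvd (by omega) h
        omega
      · intro h
        rw [show c + 1 = (n + 1) ^ (m + 2) by omega]
    set s' : State (m + 2) :=
      { s with miss := fun k => decide (digits (m + 2) (n + 1) c k = n),
               pat := pattern n α (digits (m + 2) (n + 1) c) } with hs'
    have hverdict : (counter φ).verdict (pass (counter φ).bwd s
        (tape n α (digits (m + 2) (n + 1) c)).reverse []).1 =
        if D ∣ c + 1 then
          if (s.ok && cond φ n α c) = true then .inr true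
          else if t = 0 then .inr false else .inl (s'.prepare true)
        else .inl (s'.prepare (s.ok && cond φ n α c)) := by
      change State.verdict φ (pass State.scan s _ []).1 = _
      rw [hscan]
      have h01' : s'.miss 0 = true ∧ s'.miss 1 = true ↔ D ∣ c + 1 := by
        rw [← h01]
        simp only [hs', decide_eq_true_eq]
      have hall' : (∀ k, s'.miss k = true) ↔ t = 0 := by
        rw [← hall]
        simp only [hs', decide_eq_true_eq]
      simp only [State.verdict, h01', hall']
      rfl
    have hok' : (s.ok && cond φ n α c) =
        decide (∀ r < c % D + 1, cond φ n α (D * (c / D) + r) = true) := by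
      rw [hok, Bool.eq_iff_iff]
      simp only [Bool.and_eq_true, decide_eq_true_eq]
      constructor
      · rintro ⟨h, h'⟩ r hr
        rcases Nat.lt_succ_iff_lt_or_eq.1 hr with hr | rfl
        · exact h r hr
        · rwa [Nat.div_add_mod]
      · intro h
        refine ⟨fun r hr => h r (by omega), ?_⟩
        have := h (c % D) (by omega)
        rwa [Nat.div_add_mod] at this
    -- All continuing cases share this step; they differ only in the flag `b` that is carried on.
    have hnext : ∀ b b' : Bool, t ≠ 0 →
        (counter φ).verdict (pass (counter φ).bwd s
          (tape n α (digits (m + 2) (n + 1) c)).reverse []).1 = .inl (s'.prepare b) →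
        b = decide (∀ r < (c + 1) % D, cond φ n α (D * ((c + 1) / D) + r) = true) →
        b' = decide (∃ e, (c + 1) / D ≤ e ∧ e < (n + 1) ^ m ∧
          ∀ r < D, cond φ n α (D * e + r) = true) →
        (counter φ).Decides (t + 1) s (tape n α (digits (m + 2) (n + 1) c)).reverse b' := by
      intro b b' ht0 hv hb hb'
      refine Decides.next hv ?_
      change (counter φ).Decides t (State.reset (pass State.shift _ (pass State.scan s _ []).2 []).1)
        (pass State.shift _ (pass State.scan s _ []).2 []).2 b'
      rw [hscan]
      dsimp only
      rw [pass_shift α hx s' (fun _ => rfl) b, succTuple_digits, hb']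
      exact ih (c + 1) (by omega) (by omega) _ rfl rfl hb
    have hcD : c / D < (n + 1) ^ m := Nat.div_lt_of_lt_mul (by omega)
    by_cases hd : D ∣ c + 1
    · have hmod : c % D + 1 = D := by
        have h₁ := Nat.div_add_mod c D
        have h₂ := Nat.mod_lt c hDpos
        obtain ⟨d, hd⟩ := hd
        have h₃ : D * (c / D) < D * d := by omega
        have h₄ : c / D + 1 ≤ d := Nat.lt_of_mul_lt_mul_left h₃
        have h₅ : D * (c / D + 1) ≤ D * d := Nat.mul_le_mul_left _ h₄
        rw [mul_add, mul_one] at h₅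
        omega
      rw [hmod] at hok'
      rw [if_pos hd] at hverdict
      by_cases hA : (s.ok && cond φ n α c) = true
      · rw [if_pos hA] at hverdict
        have hA' := of_decide_eq_true (hok'.symm.trans hA)
        rw [decide_eq_true (show ∃ e, _ from ⟨c / D, le_rfl, hcD, hA'⟩)]
        exact Decides.halt hverdict
      · rw [if_neg hA] at hverdict
        have hA' : ¬ ∀ r < D, cond φ n α (D * (c / D) + r) = true := by
          intro h
          exact hA (hok'.trans (decide_eq_true h))
        by_cases ht0 : t = 0
        · rw [if_pos ht0] at hverdict
          rw [decide_eq_false]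
          · exact Decides.halt hverdict
          · rintro ⟨e, he, he', h⟩
            -- No tuple is left, so the current block is the last one.
            have : c / D + 1 = (n + 1) ^ m := by
              rw [← Nat.succ_div_of_dvd hd, show c + 1 = D * (n + 1) ^ m by omega,
                Nat.mul_div_cancel_left _ hDpos]
            exact hA' (by rwa [show e = c / D by omega] at h)
        · rw [if_neg ht0] at hverdict
          refine hnext true _ ht0 hverdict ?_ ?_
          · refine (decide_eq_true fun r hr => ?_).symm
            rw [Nat.dvd_iff_mod_eq_zero.1 hd] at hr
            omega
          · rw [decide_eq_decide, Nat.succ_div_of_dvd hd]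
            constructor
            · rintro ⟨e, he, he', h⟩
              refine ⟨e, ?_, he', h⟩
              rcases he.eq_or_lt with rfl | he
              · exact absurd h hA'
              · exact he
            · rintro ⟨e, he, he', h⟩
              exact ⟨e, by omega, he', h⟩
    · rw [if_neg hd] at hverdict
      have ht0 : t ≠ 0 := by
        rintro rfl
        exact hd ⟨(n + 1) ^ m, by omega⟩
      have hdiv := Nat.succ_div_of_not_dvd hd
      have hmod : (c + 1) % D = c % D + 1 := by
        have h₁ := Nat.div_add_mod c D
        have h₂ := Nat.div_add_mod (c + 1) D
        rw [Nat.succ_div_of_not_dvd hd] at h₂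
        omega
      refine hnext _ _ ht0 hverdict ?_ ?_
      · rw [hok', hmod, hdiv]
      · rw [hdiv]

open Classical in
/-- The counting automaton decides the sentence `∃ u, ∀ v w, φ`. -/
theorem counter_decides_sentence :
    (counter φ).Decides ((n + 1) ^ (m + 2))
      ((counter φ).turn (pass (counter φ).load (counter φ).start
        ((List.range (n * (n + 1))).map (letter n α)) []).1)
      (pass (counter φ).load (counter φ).start
        ((List.range (n * (n + 1))).map (letter n α)) []).2
      (decide (∃ u : Fin m → Fin (n + 1), ∀ v w : Fin (n + 1),
        φ (pattern n α (Matrix.vecCons (v : ℕ) (Matrix.vecCons (w : ℕ) fun k => (u k : ℕ)))) =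
          true)) := by
  rw [pass_load]
  have h := counter_decides φ n α ((n + 1) ^ (m + 2)) 0 (by simp) (by positivity)
    ((counter φ).turn (shiftState n (fun _ => n) State.start (n * (n + 1)))) rfl rfl
    (by simp [counter, State.reset, shiftState, State.start])
  convert h using 2
  -- The universal variables are the two lowest digits, so they run through all pairs while the
  -- block number `e` codes `u`.
  have hdig : ∀ (e : Fin ((n + 1) ^ m)) (v w : Fin (n + 1)),
      digits (m + 2) (n + 1) ((n + 1) ^ 2 * e + ((n + 1) * w + v)) =
        Matrix.vecCons (v : ℕ) (Matrix.vecCons (w : ℕ)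
          fun k => (finFunctionFinEquiv.symm e k : ℕ)) := by
    intro e v w
    have e₀ : (n + 1) ^ 2 * (e : ℕ) + ((n + 1) * w + v) =
        (n + 1) * ((n + 1) * e + w) + v := by ring
    have e₁ : ((n + 1) ^ 2 * (e : ℕ) + ((n + 1) * w + v)) / (n + 1) = (n + 1) * e + w := by
      rw [e₀, Nat.mul_add_div n.succ_pos, Nat.div_eq_of_lt v.2, add_zero]
    have e₂ : ((n + 1) * (e : ℕ) + w) / (n + 1) = e := by
      rw [Nat.mul_add_div n.succ_pos, Nat.div_eq_of_lt w.2, add_zero]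
    funext k
    refine Fin.cases ?_ (fun k => Fin.cases ?_ (fun k => ?_) k) k
    · simp only [digits, Fin.val_zero, pow_zero, Nat.div_one, Matrix.cons_val_zero]
      rw [e₀, Nat.mul_add_mod, Nat.mod_eq_of_lt v.2]
    · simp only [digits, Fin.val_succ, Fin.val_zero, zero_add, pow_one, Matrix.cons_val_succ,
        Matrix.cons_val_zero]
      rw [e₁, Nat.mul_add_mod, Nat.mod_eq_of_lt w.2]
    · simp only [digits, Fin.val_succ, Matrix.cons_val_succ, finFunctionFinEquiv_symm_apply_val]
      rw [pow_succ' _ ((k : ℕ) + 1), ← Nat.div_div_eq_div_mul, e₁, pow_succ', ← Nat.div_div_eq_div_mul, e₂]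
  constructor
  · rintro ⟨u, hu⟩
    refine ⟨finFunctionFinEquiv u, by simp, (finFunctionFinEquiv u).2, fun r hr => ?_⟩
    have hw : r / (n + 1) < n + 1 := Nat.div_lt_of_lt_mul (by rwa [← sq])
    have := hdig (finFunctionFinEquiv u) ⟨r % (n + 1), Nat.mod_lt _ n.succ_pos⟩ ⟨_, hw⟩
    rw [Nat.div_add_mod, Equiv.symm_apply_apply] at this
    unfold cond
    rw [this]
    exact hu _ _
  · rintro ⟨e, _, he, h⟩
    refine ⟨finFunctionFinEquiv.symm ⟨e, he⟩, fun v w => ?_⟩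
    rw [← hdig ⟨e, he⟩ v w]
    refine h _ ?_
    have hv := v.2
    have hw := Nat.mul_le_mul_left (n + 1) (Nat.lt_succ_iff.1 w.2)
    rw [sq]
    nlinarith

end

end Sweep

/-! ### Encodings of graphs -/

namespace ProbeColouring

theorem flatMap_range_map_range {β : Type*} (f : ℕ → ℕ → β) (N B : ℕ) (hB : 0 < B) :
    ((List.range N).flatMap fun i => (List.range B).map (f i)) =
      (List.range (N * B)).map fun p => f (p / B) (p % B) := by
  induction N with
  | zero => simp
  | succ N ih =>
    rw [List.range_succ, List.flatMap_append, ih, Nat.succ_mul, List.range_add, List.map_append]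
    congr 1
    simp only [List.flatMap_cons, List.flatMap_nil, List.append_nil, List.map_map]
    refine List.map_congr_left fun j hj => ?_
    have hj' : j < B := List.mem_range.1 hj
    simp only [Function.comp_apply]
    rw [mul_comm N B, Nat.mul_add_div hB, Nat.mul_add_mod, Nat.div_eq_of_lt hj',
      Nat.mod_eq_of_lt hj', add_zero]

open Classical in
/-- The adjacency of the vertices with numbers `i` and `j`. -/
noncomputable def adjacency (x : InputGraph) (i j : ℕ) : Bool :=
  decide (∃ (hi : i < x.1) (hj : j < x.1), x.2.Adj ⟨i, hi⟩ ⟨j, hj⟩)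

theorem adjacency_eq_true_iff (x : InputGraph) (i j : ℕ) :
    adjacency x i j = true ↔ ∃ v w : Fin x.1, (v : ℕ) = i ∧ (w : ℕ) = j ∧ x.2.Adj v w := by
  simp only [adjacency, decide_eq_true_eq]
  constructor
  · rintro ⟨hi, hj, h⟩
    exact ⟨_, _, rfl, rfl, h⟩
  · rintro ⟨v, w, rfl, rfl, h⟩
    exact ⟨v.2, w.2, h⟩

theorem adjacency_val (x : InputGraph) (v w : Fin x.1) :
    adjacency x v w = true ↔ x.2.Adj v w := by
  simp [adjacency]

theorem encodeGraph_eq (x : InputGraph) :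
    encodeGraph x =
      (List.range (x.1 * (x.1 + 1))).map (Sweep.letter x.1 (adjacency x)) := by
  classical
  have h := flatMap_range_map_range
    (fun i j => if j < x.1 then some (adjacency x i j) else none) x.1 (x.1 + 1) x.1.succ_pos
  refine Eq.trans ?_ h
  unfold encodeGraph
  rw [← List.map_coe_finRange_eq_range (n := x.1), List.flatMap_map]
  congr 1
  funext i
  rw [List.range_succ, List.map_append, ← List.map_coe_finRange_eq_range, List.map_map]
  congr 1
  · refine List.map_congr_left fun j _ => ?_
    simp [adjacency]
  · simp

theorem length_encodeGraph (x : InputGraph) : (encodeGraph x).length = x.1 * (x.1 + 1) := by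
  rw [encodeGraph_eq, List.length_map, List.length_range]

/-! ### Colourings of graphs without large induced matchings -/

section Graph

variable {V : Type*} {G : SimpleGraph V}

/-- An induced matching with `t` edges. -/
theorem copies_isIndContained {t : ℕ} (a b : Fin t → V) (hab : ∀ i j, G.Adj (a i) (b j) ↔ i = j)
    (haa : ∀ i j, ¬ G.Adj (a i) (a j)) (hbb : ∀ i j, ¬ G.Adj (b i) (b j)) :
    (copies t (path 2)).IsIndContained G := by
  have hinj : Function.Injective fun p : Fin t × Fin 2 => if p.2 = 0 then a p.1 else b p.1 := by
    rintro ⟨i, p⟩ ⟨j, q⟩ h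
    have hp : p = 0 ∨ p = 1 := by omega
    have hq : q = 0 ∨ q = 1 := by omega
    rcases hp with rfl | rfl <;> rcases hq with rfl | rfl
    · have h' : a i = a j := h
      have := (hab i i).2 rfl
      rw [h', hab] at this
      rw [this]
    · have h' : a i = b j := h
      have := (hab i i).2 rfl
      rw [h'] at this
      exact absurd this (hbb _ _)
    · have h' : b i = a j := h
      have := (hab i i).2 rfl
      rw [h'] at this
      exact absurd this (haa _ _)
    · have h' : b i = b j := h
      have := (hab i i).2 rfl
      rw [h', hab] at this
      rw [this]
  refine ⟨⟨⟨_, hinj⟩, ?_⟩⟩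
  rintro ⟨i, p⟩ ⟨j, q⟩
  have hp : p = 0 ∨ p = 1 := by omega
  have hq : q = 0 ∨ q = 1 := by omega
  rcases hp with rfl | rfl <;> rcases hq with rfl | rfl <;>
    simp [copies, SimpleGraph.pathGraph_adj, hab, haa, hbb, G.adj_comm (b _) (a _), eq_comm]

/-- In a `k`-coloured graph without an induced matching of size `s + 1`, every independent set
extends to one of the form `V ∖ N(S)` with `|S| ≤ ks`. -/
theorem exists_small_dominating [Finite V] {s k : ℕ}
    (hfree : IsFree (copies (s + 1) (path 2)) G) (C : G.Coloring (Fin k)) {I : Set V}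
    (hI : G.IsIndepSet I) :
    ∃ S : Finset V, S.card ≤ k * s ∧ (∀ v ∈ I, ∀ u ∈ S, ¬ G.Adj u v) ∧
      ∀ v w, G.Adj v w → ∃ u ∈ S, G.Adj u v ∨ G.Adj u w := by
  classical
  have := Fintype.ofFinite V
  obtain ⟨J, hIJ, hJ⟩ := Set.Finite.exists_le_maximal (Set.toFinite {J : Set V | G.IsIndepSet J}) hI
  have hJind : G.IsIndepSet J := hJ.1
  have hJadj : ∀ v ∈ J, ∀ w ∈ J, ¬ G.Adj v w := fun v hv w hw h => hJind hv hw h.ne h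
  let dominating : Set (Finset V) := {S | ↑S ⊆ J ∧ ∀ v ∉ J, ∃ u ∈ S, G.Adj u v}
  have hne : J.toFinset ∈ dominating := by
    refine ⟨by simp, fun v hv => ?_⟩
    by_contra! h
    have h' : ∀ u ∈ J, ¬ G.Adj u v := by simpa using h
    -- A vertex outside `J` without a neighbour in `J` could be added to `J`.
    refine hv (hJ.2 (y := insert v J) ?_ (Set.subset_insert v J) (Set.mem_insert v J))
    refine Set.pairwise_insert.2 ⟨hJind, fun w hw _ => ⟨fun hvw => h' w hw hvw.symm, h' w hw⟩⟩
  obtain ⟨S, -, hS⟩ := Set.Finite.exists_le_minimal (Set.toFinite dominating) hne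
  have hSJ : ∀ u ∈ S, u ∈ J := fun u hu => hS.1.1 hu
  have hprivate : ∀ u ∈ S, ∃ p, G.Adj u p ∧ ∀ u' ∈ S, G.Adj u' p → u' = u := by
    intro u hu
    by_contra! h
    -- Without a private neighbour, `u` would be superfluous in the minimal set `S`.
    have : S.erase u ∈ dominating := by
      refine ⟨fun v hv => hSJ v (Finset.mem_of_mem_erase hv), fun v hv => ?_⟩
      obtain ⟨u', hu', hadj⟩ := hS.1.2 v hv
      by_cases huu : u' = u
      · subst huu
        obtain ⟨w, hw, hwv, hne⟩ := h v hadj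
        exact ⟨w, Finset.mem_erase.2 ⟨hne, hw⟩, hwv⟩
      · exact ⟨u', Finset.mem_erase.2 ⟨huu, hu'⟩, hadj⟩
    exact Finset.notMem_erase u S (hS.2 this (Finset.erase_subset u S) hu)
  choose! p hp hp' using hprivate
  refine ⟨S, ?_, fun v hv u hu => hJadj u (hSJ u hu) v (hIJ hv), fun v w hvw => ?_⟩
  · by_contra! hcard
    -- Pigeonhole on the colours of the private neighbours; those of one colour are pairwise
    -- non-adjacent.
    obtain ⟨c, -, hc⟩ := Finset.exists_lt_card_fiber_of_mul_lt_card_of_maps_to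
      (s := S) (t := Finset.univ) (f := fun u => C (p u)) (n := s)
      (fun _ _ => Finset.mem_univ _) (by simpa using hcard)
    obtain ⟨T, hT, hTcard⟩ := Finset.exists_subset_card_eq (Nat.succ_le_of_lt hc)
    let e := (T.equivFinOfCardEq hTcard).symm
    have hTS : ∀ i, (e i : V) ∈ S := fun i => (Finset.mem_filter.1 (hT (e i).2)).1
    have hcol : ∀ i, C (p (e i)) = c := fun i => (Finset.mem_filter.1 (hT (e i).2)).2
    refine hfree (copies_isIndContained (fun i => (e i : V)) (fun i => p (e i)) ?_ ?_ ?_)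
    · intro i j
      constructor
      · intro h
        exact e.injective (Subtype.ext (hp' _ (hTS j) _ (hTS i) h))
      · rintro rfl
        exact hp _ (hTS i)
    · exact fun i j => hJadj _ (hSJ _ (hTS i)) _ (hSJ _ (hTS j))
    · exact fun i j h => C.valid h (by rw [hcol, hcol])
  · by_cases hv : v ∈ J
    · obtain ⟨u, hu, huw⟩ := hS.1.2 w fun hw => hJadj v hv w hw hvw
      exact ⟨u, hu, Or.inr huw⟩
    · obtain ⟨u, hu, huv⟩ := hS.1.2 v hv
      exact ⟨u, hu, Or.inl huv⟩

/-! ### From probe graphs to induced matchings -/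

/-- A probe `(P₂ + sP₁)`-free graph has no induced matching of size `s + 1`. -/
theorem isFree_copies_of_isProbeFree {s : ℕ} (h : IsProbeFree (P2sP1 s) G) :
    IsFree (copies (s + 1) (path 2)) G := by
  rintro ⟨f⟩
  obtain ⟨P, N, hN, hind, F, hF, hfree⟩ := h
  have hmatch : ∀ i, G.Adj (f (i, 0)) (f (i, 1)) := fun i =>
    f.map_adj_iff.2 ⟨rfl, by simp [SimpleGraph.pathGraph_adj]⟩
  have hend : ∀ i, ∃ p, f (i, p) ∉ N := by
    intro i
    by_contra! h
    exact hind (h 0) (h 1) (hmatch i).ne (hmatch i)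
  choose p hp using hend
  have hnot : ∀ i j q r, i ≠ j → ¬ G.Adj (f (i, q)) (f (j, r)) := fun i j q r hij h =>
    hij (f.map_adj_iff.1 h).1
  have hFl : ∀ i v, ¬ F.Adj (f (i, p i)) v := fun i v h => hp i (hF _ _ h).1
  have hFr : ∀ i v, ¬ F.Adj v (f (i, p i)) := fun i v h => hp i (hF _ _ h).2
  let g : Fin 2 ⊕ Fin s × Fin 1 → Fin (s + 1) × Fin 2
    | .inl q => (0, q)
    | .inr j => (j.1.succ, p j.1.succ)
  have hg : Function.Injective g := by
    rintro (q | ⟨j, u⟩) (r | ⟨l, v⟩) h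
    · simp only [g, Prod.mk.injEq, true_and] at h
      rw [h]
    · simp only [g, Prod.mk.injEq] at h
      exact absurd h.1.symm (Fin.succ_ne_zero l)
    · simp only [g, Prod.mk.injEq] at h
      exact absurd h.1 (Fin.succ_ne_zero j)
    · simp only [g, Prod.mk.injEq, Fin.succ_inj] at h
      rw [h.1, Subsingleton.elim u v]
  -- The edge kept whole has a probe end too, so `F` adds nothing on its two ends.
  have hFzero : ∀ q r, ¬ F.Adj (f (0, q)) (f (0, r)) := by
    intro q r h
    have h0 : f (0, p 0) ∉ N := hp 0
    have hq : q ≠ p 0 := by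
      rintro rfl
      exact hFl _ _ h
    have hr : r ≠ p 0 := by
      rintro rfl
      exact hFr _ _ h
    have : q = r := by omega
    rw [this] at h
    exact F.loopless.irrefl _ h
  refine hfree ⟨⟨⟨fun x => f (g x), f.injective.comp hg⟩, ?_⟩⟩
  rintro (q | ⟨j, u⟩) (r | ⟨l, v⟩)
  · have : G.Adj (f (0, q)) (f (0, r)) ↔ (path 2).Adj q r := by
      rw [f.map_adj_iff]
      exact ⟨fun h => h.2, fun h => ⟨rfl, h⟩⟩
    simp [g, hFzero, this]
  · simp [g, hFr, hnot _ _ _ _ (Fin.succ_ne_zero l).symm]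
  · simp [g, hFl, hnot _ _ _ _ (Fin.succ_ne_zero j)]
  · have : ¬ G.Adj (f (j.succ, p j.succ)) (f (l.succ, p l.succ)) := by
      by_cases h : j = l
      · subst h
        exact G.loopless.irrefl _
      · exact hnot _ _ _ _ fun h' => h (Fin.succ_inj.1 h')
    have hF' : ¬ F.Adj (f (j.succ, p j.succ)) (f (l.succ, p l.succ)) := hFl _ _
    simpa [g, copies, SimpleGraph.pathGraph_adj] using ⟨this, hF'⟩

end Graph

/-! ### The colouring algorithm -/

/-- The number of the variable for the vertex `i` of the `j`-th dominating set. -/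
def slot {k R : ℕ} (j : Fin k) (i : Fin R) : Fin (k * R + 2) := (finProdFinEquiv (j, i)).succ.succ

/-- The vertex `0` avoids the neighbourhood of one of `k` sets of `R` vertices, and the vertices
`0` and `1`, if adjacent, do not both avoid any of them. -/
def colourCondition (k R : ℕ) (π : Fin (k * R + 2) → Fin (k * R + 2) → Bool) : Bool :=
  decide ((∃ j : Fin k, ∀ i : Fin R, π (slot j i) 0 = false) ∧
    ∀ j : Fin k, π 0 1 = true → ∃ i : Fin R, π (slot j i) 0 = true ∨ π (slot j i) 1 = true)

theorem colourCondition_eq_true_iff {k R : ℕ} (π : Fin (k * R + 2) → Fin (k * R + 2) → Bool) :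
    colourCondition k R π = true ↔ (∃ j : Fin k, ∀ i : Fin R, ¬ π (slot j i) 0 = true) ∧
      ∀ j : Fin k, π 0 1 = true → ∃ i : Fin R, π (slot j i) 0 = true ∨ π (slot j i) 1 = true := by
  simp [colourCondition]

/-- A `k`-colouring is a cover by `k` independent sets of the form `V ∖ N(S)`. -/
theorem colorable_iff_exists_colourCondition {s k : ℕ} (hk : 1 ≤ k) (x : InputGraph)
    (hfree : IsFree (copies (s + 1) (path 2)) x.2) :
    (∃ u : Fin (k * (k * s)) → Fin (x.1 + 1), ∀ v w : Fin (x.1 + 1),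
      colourCondition k (k * s) (Sweep.pattern x.1 (adjacency x)
        (Matrix.vecCons (v : ℕ) (Matrix.vecCons (w : ℕ) fun i => (u i : ℕ)))) = true) ↔
      x.2.Colorable k := by
  -- The range conditions follow from adjacency, so the value `n` acts as an isolated dummy vertex.
  have hpat : ∀ {M : ℕ} (y : Fin M → ℕ) (i j : Fin M),
      Sweep.pattern x.1 (adjacency x) y i j = true ↔ adjacency x (y i) (y j) = true := by
    intro M y i j
    simp only [Sweep.pattern, decide_eq_true_eq]
    refine ⟨fun h => h.2.2, fun h => ⟨?_, ?_, h⟩⟩ <;>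
      obtain ⟨v, w, hv, hw, -⟩ := (adjacency_eq_true_iff x _ _).1 h
    · exact hv ▸ v.2
    · exact hw ▸ w.2
  simp only [colourCondition_eq_true_iff, hpat, slot, Matrix.cons_val_succ, Matrix.cons_val_zero,
    Matrix.cons_val_one]
  constructor
  · rintro ⟨u, hu⟩
    have hcol : ∀ v : Fin x.1, ∃ j : Fin k, ∀ i : Fin (k * s),
        ¬ adjacency x (u (finProdFinEquiv (j, i))) v = true := fun v => (hu v.castSucc 0).1
    choose C hC using hcol
    refine ⟨SimpleGraph.Coloring.mk C fun {v w} hvw hCvw => ?_⟩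
    obtain ⟨i, h | h⟩ := (hu v.castSucc w.castSucc).2 (C v) ((adjacency_val x v w).2 hvw)
    · exact hC v i h
    · rw [hCvw] at h
      exact hC w i h
  · rintro ⟨C⟩
    have hS := fun j : Fin k => exists_small_dominating (s := s) hfree C (I := {v | C v = j})
      (fun v hv w hw _ h => C.valid h (hv.trans hw.symm))
    choose S hScard hSI hSadj using hS
    -- Sets with fewer than `k * s` vertices are padded with the dummy value `n`.
    have henum : ∀ j, ∃ e : Fin (k * s) → Fin (x.1 + 1),
        (∀ i (v : Fin x.1), (v : ℕ) = e i → v ∈ S j) ∧ ∀ v ∈ S j, ∃ i, (e i : ℕ) = v := by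
      intro j
      let e' := (S j).equivFin
      refine ⟨fun i => if h : (i : ℕ) < (S j).card then (e'.symm ⟨i, h⟩ : Fin x.1).castSucc
        else Fin.last x.1, fun i v hv => ?_, fun v hv => ?_⟩
      · beta_reduce at hv
        by_cases h : (i : ℕ) < (S j).card
        · rw [dif_pos h, Fin.val_castSucc, Fin.val_inj] at hv
          rw [hv]
          exact (e'.symm ⟨i, h⟩).2
        · rw [dif_neg h, Fin.val_last] at hv
          exact absurd hv v.2.ne
      · refine ⟨⟨e' ⟨v, hv⟩, (e' ⟨v, hv⟩).2.trans_le (hScard j)⟩, ?_⟩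
        simp
    choose e he he' using henum
    refine ⟨fun i => e (finProdFinEquiv.symm i).1 (finProdFinEquiv.symm i).2, fun v w => ?_⟩
    simp only [Equiv.symm_apply_apply]
    constructor
    · by_cases hv : (v : ℕ) < x.1
      · refine ⟨C ⟨v, hv⟩, fun i h => ?_⟩
        obtain ⟨u, v', hu, hv', h⟩ := (adjacency_eq_true_iff x _ _).1 h
        exact hSI (C ⟨v, hv⟩) v' (congrArg C (Fin.ext hv')) u (he _ i u hu) h
      -- The dummy value avoids every neighbourhood, so any index serves; one exists because `1 ≤
      -- k`.
      · refine ⟨⟨0, hk⟩, fun i h => ?_⟩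
        obtain ⟨-, v', -, hv', -⟩ := (adjacency_eq_true_iff x _ _).1 h
        exact hv (hv' ▸ v'.2)
    · intro j h
      obtain ⟨v', w', hv, hw, h⟩ := (adjacency_eq_true_iff x _ _).1 h
      obtain ⟨u, hu, hadj⟩ := hSadj j _ _ h
      obtain ⟨i, hi⟩ := he' j u hu
      refine ⟨i, ?_⟩
      rw [hi, ← hv, ← hw, adjacency_val, adjacency_val]
      exact hadj

/-- Colouring is polynomial-time solvable on graphs without large induced matchings. -/
theorem polyTimeSolvableOn_colorable {C : InputGraph → Prop} {s k : ℕ} (hk : 1 ≤ k)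
    (hC : ∀ x, C x → IsFree (copies (s + 1) (path 2)) x.2) :
    PolyTimeSolvableOn C fun x => x.2.Colorable k := by
  classical
  refine Sweep.polyTimeSolvableOn_of_automaton
    (Sweep.counter (colourCondition k (k * s)))
    ((Polynomial.X + 1) ^ (k * (k * s) + 2)) fun x hx => ?_
  have hdec := Sweep.counter_decides_sentence (colourCondition k (k * s)) x.1 (adjacency x)
  rw [← encodeGraph_eq] at hdec
  refine ⟨_, ?_, hdec.mono ?_⟩
  · rw [decide_eq_true_iff]
    exact colorable_iff_exists_colourCondition hk x (hC x hx)
  · rw [length_encodeGraph]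
    simp only [Polynomial.eval_pow, Polynomial.eval_add, Polynomial.eval_X, Polynomial.eval_one]
    exact Nat.pow_le_pow_left (Nat.succ_le_succ (Nat.le_mul_of_pos_right _ x.1.succ_pos)) _

end ProbeColouring

theorem mainTheorem5 (s : ℕ) :
    (∀ k : ℕ, 1 ≤ k →
      ProbeColouring.PolyTimeSolvableOn
        (fun x => ProbeColouring.IsProbeFree (ProbeColouring.P2sP1 s) x.2)
        (fun x => x.2.Colorable k)) ∧
    (∀ (V : Type*) [Finite V] (G : SimpleGraph V),
      ProbeColouring.IsProbeFree (ProbeColouring.P2sP1 s) G →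
        ProbeColouring.IsFree (ProbeColouring.copies (s + 1) (ProbeColouring.path 2)) G) :=
  ⟨fun _ hk => ProbeColouring.polyTimeSolvableOn_colorable hk fun _ hx =>
      ProbeColouring.isFree_copies_of_isProbeFree hx,
    fun _ _ _ h => ProbeColouring.isFree_copies_of_isProbeFree h⟩
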